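/- Let $G=(V,E)$ be a finite undirected graph without loops or multiple edges, and let $\Delta(G)$ denote the largest degree of a vertex of $G$; only graphs with $\Delta(G)\ge 1$ are considered. Let $m=(\mu_1,\dots,\mu_k)$ be a vector of positive integers with $\mu_1+\dots+\mu_k=|V|$. For a complex $|E|\times\frac{k(k+1)}{2}$ matrix $Z=(z^{uv}_{ij})$, with rows indexed by the edges $\{u,v\}\in E$ and columns indexed by the unordered pairs $\{i,j\}$ with $1\le i,j\le k$ ($i=j$ allowed), so that $z^{uv}_{ij}=z^{vu}_{ij}=z^{uv}_{ji}=z^{vu}_{ji}$, put $$Q_{G,m}(Z)=\sum_{\substack{\phi:V\to\{1,\dots,k\}\\ |\phi^{-1}(i)|=\mu_i\ \text{for}\ i=1,\dots,k}}\ \prod_{\{u,v\}\in E} z^{uv}_{\phi(u)\phi(v)} .$$ Theorem. There exists an absolute constant $\alpha>0$ (one can choose $\alpha=0.107$) such that for every such graph $G$, every such vector $m$ and every such complex matrix $Z$ satisfying $$\left|1-z^{uv}_{ij}\right|\le\frac{\alpha}{\Delta(G)}\qquad\text{for all } \{u,v\}\in E \text{ and all } 1\le i,j\le k,$$ one has $Q_{G,m}(Z)\ne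 0$. -/

import Mathlib

/-- The partition function of edge-colored graph homomorphisms with multiplicities,
`Q_{G,m}(Z) = ∑_φ ∏_{{u,v} ∈ E} z^{uv}_{φ(u)φ(v)}`, where `φ` ranges over the maps from `V` to the
`k`-element index set with exactly `m i` vertices mapped to `i`, for every index `i`.
The rows of `Z` are indexed by the edges of `G`, the columns by the unordered pairs (with `i = j`
allowed) of indices; `e.map φ` is the unordered pair `{φ(u), φ(v)}` when `e = {u, v}`. -/
noncomputable def partitionFunction {V : Type*} [Fintype V] [DecidableEq V]
    (G : SimpleGraph V) [DecidableRel G.Adj] {k : ℕ} (m : Fin k → ℕ)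
    (Z : Matrix G.edgeSet (Sym2 (Fin k)) ℂ) : ℂ :=
  ∑ φ : V → Fin k with ∀ i, (Finset.univ.filter fun v => φ v = i).card = m i,
    ∏ e : G.edgeSet, Z e ((e : Sym2 V).map φ)

/-!
The multiplicities disappear on replacing colours by slots. Fix one map `φ₀ : V → Fin k` with the
prescribed fibre sizes; then `∑ F (φ₀ ∘ σ)` over the permutations `σ` of `V` is a positive multiple
of the sum of `F` over all admissible maps (`sum_perm_comp_eq_smul`). Writing the entries of `Z` as
exponentials, it remains to see that `∑ π, exp (energy x π)` does not vanish, where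
`energy x π = ∑ u, ∑ w, x u w (π u) (π w)` and the total size of the interactions `x` at every
vertex is at most a small constant `R` (`sum_exp_energy_ne_zero`).

For a set `P` of prescribed values let `Q_P` be the sum over the permutations respecting `P`, and
`Q_{P, u ↦ s}` the sum in which moreover `u ↦ s`. By induction on the number of permutations that
respect `P`, and for all admissible `x` at once, `Q_P ≠ 0` and any two of the numbers
`Q_{P, u ↦ s}`, `Q_{P, u ↦ t}` form an angle of cosine at least `c` (`sectorBound_of_norm_le`).
Numbers in such a sector cannot cancel, so `c * ∑ s, ‖Q_{P, u ↦ s}‖ ≤ ‖Q_P‖`; and since each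
`Q_{P, u ↦ s}` also forms an angle of cosine at least `c` with `Q_P = ∑ u, Q_{P, u ↦ s}`, likewise
`c * ∑ u, ‖Q_{P, u ↦ s}‖ ≤ ‖Q_P‖` with the slot fixed and the vertex varying.

For the inductive step, exchanging the slots `i` and `j` in `x` turns `Q_{P, v ↦ i}` into
`Q_{P, v ↦ j}`. Along the segment from `x` to the exchanged interaction, only the pairs containing
`v` or the vertex sitting at `j` change, whence the logarithmic derivative of `Q_{P, v ↦ i}` has
modulus at most `2 R (1 / c + 1 / c ^ 2)` (`norm_sum_energy_le`). This bounds the angle between the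
end points (`cos_mul_norm_le_re_of_norm_deriv_le`), so the induction closes as soon as
`c ≤ cos (2 R (1 / c + 1 / c ^ 2))`. For `α = 0.107` one may take `R = 0.1135` and `c = 0.755`.
-/

open Finset
open scoped ComplexConjugate

/-! ### Curves in the punctured plane -/

/-- A nonvanishing curve whose logarithmic derivative has modulus at most `C` on `[0, 1]` turns by an
angle of at most `C`. -/
theorem cos_mul_norm_le_re_of_norm_deriv_le {f f' : ℝ → ℂ} {C : ℝ}
    (hf : ∀ t, HasDerivAt f (f' t) t) (hf' : Continuous f')
    (h0 : ∀ t ∈ Set.Icc (0 : ℝ) 1, f t ≠ 0)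
    (hC : ∀ t ∈ Set.Icc (0 : ℝ) 1, ‖f' t‖ ≤ C * ‖f t‖) (hCπ : C ≤ Real.pi) :
    Real.cos C * (‖f 0‖ * ‖f 1‖) ≤ (f 0 * conj (f 1)).re := by
  have hcont : Continuous f := continuous_iff_continuousAt.2 fun t => (hf t).continuousAt
  -- The logarithmic derivative, continued by constants outside `[0, 1]`.
  set q : ℝ → ℂ := Set.IccExtend (zero_le_one' ℝ) fun t => f' t / f t with hq
  have hqc : Continuous q := by
    refine Continuous.Icc_extend' ?_
    exact (hf'.comp continuous_subtype_val).div (hcont.comp continuous_subtype_val)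
      fun t => h0 t t.2
  have hqv : ∀ t ∈ Set.Icc (0 : ℝ) 1, q t = f' t / f t := fun t ht =>
    Set.IccExtend_of_mem _ _ ht
  set g : ℝ → ℂ := fun t => ∫ s in (0 : ℝ)..t, q s with hg
  have hgd : ∀ t, HasDerivAt g (q t) t := fun t => hqc.integral_hasStrictDerivAt 0 t |>.hasDerivAt
  have hg0 : g 0 = 0 := by simp [hg]
  have hconst : f 1 * Complex.exp (-g 1) = f 0 * Complex.exp (-g 0) := by
    have hd : ∀ t, HasDerivAt (fun t => f t * Complex.exp (-g t))
        (f' t * Complex.exp (-g t) + f t * (Complex.exp (-g t) * -q t)) t := fun t =>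
      (hf t).mul (hgd t).neg.cexp
    refine constant_of_has_deriv_right_zero
      (f := fun t => f t * Complex.exp (-g t)) (a := 0) (b := 1)
      (fun t _ => (hd t).continuousAt.continuousWithinAt) ?_ 1 (by simp)
    intro t ht
    have ht' : t ∈ Set.Icc (0 : ℝ) 1 := ⟨ht.1, ht.2.le⟩
    have h := (hd t).hasDerivWithinAt (s := Set.Ici t)
    convert h using 1
    rw [hqv t ht']
    field_simp [h0 t ht']
    ring
  have hgn : ‖g 1‖ ≤ C := by
    have := intervalIntegral.norm_integral_le_of_norm_le_const (a := 0) (b := 1) (f := q) (C := C)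
      (fun t ht => by
        rw [Set.uIoc_of_le zero_le_one] at ht
        have ht' : t ∈ Set.Icc (0 : ℝ) 1 := ⟨ht.1.le, ht.2⟩
        rw [hqv t ht', norm_div, div_le_iff₀ (norm_pos_iff.2 (h0 t ht'))]
        exact hC t ht')
    simpa using this
  have h1 : f 1 = f 0 * Complex.exp (g 1) := by
    have := congrArg (· * Complex.exp (g 1)) hconst
    simpa [hg0, mul_assoc, ← Complex.exp_add] using this
  have him : Real.cos C ≤ Real.cos (g 1).im := by
    rw [← Real.cos_abs (g 1).im]
    exact Real.cos_le_cos_of_nonneg_of_le_pi (abs_nonneg _) hCπ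
      ((Complex.abs_im_le_norm _).trans hgn)
  have hre : (f 0 * conj (f 1)).re = ‖f 0‖ * ‖f 1‖ * Real.cos (g 1).im := by
    rw [h1, map_mul, ← mul_assoc, Complex.mul_conj, norm_mul, Complex.norm_exp,
      Complex.re_ofReal_mul, Complex.conj_re, Complex.exp_re, Complex.normSq_eq_norm_sq]
    ring
  rw [hre, mul_comm]
  gcongr

/-! ### Sums over permutations with prescribed values -/

section Perm

variable {V : Type*} [Fintype V]

/-- The exponent attached to a permutation `π` that places the vertex `u` in the slot `π u`. The sum
is over all ordered pairs, the diagonal included, and `x` need not be symmetric. -/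
def energy (x : V → V → V → V → ℂ) (π : Equiv.Perm V) : ℂ :=
  ∑ u, ∑ w, x u w (π u) (π w)

theorem energy_swap (x : V → V → V → V → ℂ) (τ π : Equiv.Perm V) :
    energy (fun u w s t => x u w (τ s) (τ t)) π = energy x (τ * π) := rfl

theorem energy_segment (x D : V → V → V → V → ℂ) (r : ℝ) (π : Equiv.Perm V) :
    energy (fun u w s t => x u w s t + r * D u w s t) π = energy x π + r * energy D π := by
  simp [energy, sum_add_distrib, mul_sum]

variable [DecidableEq V]

/-- The permutations taking the values prescribed by `P`, where `(u, s) ∈ P` demands `u ↦ s`. The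
prescriptions may contradict each other, in which case the set is empty. -/
def pinned (P : Finset (V × V)) : Finset (Equiv.Perm V) :=
  univ.filter fun π => ∀ p ∈ P, π p.1 = p.2

/-- The sum of `exp (energy x π)` over the permutations `π` that respect `P`; it is `0` for
contradictory `P`. -/
noncomputable def pinnedSum (x : V → V → V → V → ℂ) (P : Finset (V × V)) : ℂ :=
  ∑ π ∈ pinned P, Complex.exp (energy x π)

theorem mem_pinned {P : Finset (V × V)} {π : Equiv.Perm V} :
    π ∈ pinned P ↔ ∀ p ∈ P, π p.1 = p.2 := by simp [pinned]

theorem mem_pinned_insert {P : Finset (V × V)} {u s : V} {π : Equiv.Perm V} :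
    π ∈ pinned (insert (u, s) P) ↔ π u = s ∧ π ∈ pinned P := by
  simp [mem_pinned]

theorem pinned_insert (P : Finset (V × V)) (u s : V) :
    pinned (insert (u, s) P) = (pinned P).filter fun π => π u = s := by
  ext π; rw [mem_pinned_insert, mem_filter, and_comm]

theorem sum_pinned_insert {P : Finset (V × V)} (u s : V) (f : Equiv.Perm V → ℂ) :
    ∑ π ∈ pinned (insert (u, s) P), f π = ∑ π ∈ pinned P, if π u = s then f π else 0 := by
  rw [pinned_insert, sum_filter]

theorem sum_sum_pinned_insert_slot (P : Finset (V × V)) (u : V) (f : Equiv.Perm V → ℂ) :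
    ∑ s, ∑ π ∈ pinned (insert (u, s) P), f π = ∑ π ∈ pinned P, f π := by
  simp_rw [sum_pinned_insert]
  rw [sum_comm]
  simp

theorem sum_sum_pinned_insert_vertex (P : Finset (V × V)) (s : V) (f : Equiv.Perm V → ℂ) :
    ∑ u, ∑ π ∈ pinned (insert (u, s) P), f π = ∑ π ∈ pinned P, f π := by
  simp_rw [sum_pinned_insert]
  rw [sum_comm]
  refine sum_congr rfl fun π _ => ?_
  simp_rw [← Equiv.eq_symm_apply]
  simp

/-- The statement proved by induction: `pinnedSum x P` does not vanish unless the prescriptions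
contradict each other, and for each vertex `u` the sums with the further prescription `u ↦ s`, for
varying `s`, form pairwise angles of cosine at least `c`. The inequality is trivially true where one
of the sums is zero. -/
def SectorBound (c : ℝ) (x : V → V → V → V → ℂ) (P : Finset (V × V)) : Prop :=
  ((pinned P).Nonempty → pinnedSum x P ≠ 0) ∧
    ∀ u s t, c * (‖pinnedSum x (insert (u, s) P)‖ * ‖pinnedSum x (insert (u, t) P)‖) ≤
      (pinnedSum x (insert (u, s) P) * conj (pinnedSum x (insert (u, t) P))).re

theorem mul_sum_norm_le_re_of_sector {c : ℝ} {x : V → V → V → V → ℂ} {P : Finset (V × V)}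
    (h : ∀ u s t, c * (‖pinnedSum x (insert (u, s) P)‖ * ‖pinnedSum x (insert (u, t) P)‖) ≤
      (pinnedSum x (insert (u, s) P) * conj (pinnedSum x (insert (u, t) P))).re) (u s : V) :
    c * (‖pinnedSum x (insert (u, s) P)‖ * ∑ t, ‖pinnedSum x (insert (u, t) P)‖) ≤
      (pinnedSum x (insert (u, s) P) * conj (pinnedSum x P)).re := by
  have hP : pinnedSum x P = ∑ t, pinnedSum x (insert (u, t) P) :=
    (sum_sum_pinned_insert_slot P u _).symm
  rw [hP, map_sum, mul_sum, mul_sum, mul_sum, Complex.re_sum]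
  exact sum_le_sum fun t _ => h u s t

theorem mul_norm_le_re_of_sector {c : ℝ} (hc : 0 < c) {x : V → V → V → V → ℂ}
    {P : Finset (V × V)}
    (h : ∀ u s t, c * (‖pinnedSum x (insert (u, s) P)‖ * ‖pinnedSum x (insert (u, t) P)‖) ≤
      (pinnedSum x (insert (u, s) P) * conj (pinnedSum x (insert (u, t) P))).re) (u s : V) :
    c * (‖pinnedSum x (insert (u, s) P)‖ * ‖pinnedSum x P‖) ≤
      (pinnedSum x (insert (u, s) P) * conj (pinnedSum x P)).re := by
  refine le_trans ?_ (mul_sum_norm_le_re_of_sector h u s)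
  have hP : ‖pinnedSum x P‖ ≤ ∑ t, ‖pinnedSum x (insert (u, t) P)‖ := by
    rw [pinnedSum, ← sum_sum_pinned_insert_slot P u]
    exact norm_sum_le _ _
  gcongr

/-- If the `a i` sum to `z ≠ 0` and each forms with `z` an angle of cosine at least `c`, then their
absolute values sum to at most `‖z‖ / c`: project onto the direction of `z`. -/
theorem mul_sum_norm_le_of_re {ι : Type*} (s : Finset ι) {c : ℝ} {z : ℂ} {a : ι → ℂ}
    (hz : ∑ i ∈ s, a i = z) (h : ∀ i ∈ s, c * (‖a i‖ * ‖z‖) ≤ (a i * conj z).re) (h0 : z ≠ 0) :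
    c * ∑ i ∈ s, ‖a i‖ ≤ ‖z‖ := by
  have h1 : (c * ∑ i ∈ s, ‖a i‖) * ‖z‖ ≤ ‖z‖ * ‖z‖ := by
    calc (c * ∑ i ∈ s, ‖a i‖) * ‖z‖ = ∑ i ∈ s, c * (‖a i‖ * ‖z‖) := by
          rw [mul_assoc, sum_mul, mul_sum]
      _ ≤ ∑ i ∈ s, (a i * conj z).re := sum_le_sum h
      _ = ‖z‖ * ‖z‖ := by
          rw [← Complex.re_sum, ← sum_mul, hz, Complex.mul_conj, Complex.normSq_eq_norm_sq,
            Complex.ofReal_re, sq]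
  exact le_of_mul_le_mul_right h1 (norm_pos_iff.2 h0)

theorem pinnedSum_eq_zero_of_not_nonempty {x : V → V → V → V → ℂ} {P : Finset (V × V)}
    (h : ¬ (pinned P).Nonempty) : pinnedSum x P = 0 := by
  rw [pinnedSum, not_nonempty_iff_eq_empty.1 h, sum_empty]

theorem pinnedSum_insert_eq_zero {x : V → V → V → V → ℂ} {P : Finset (V × V)} (u s : V)
    (h : ¬ (pinned P).Nonempty) : pinnedSum x (insert (u, s) P) = 0 := by
  apply pinnedSum_eq_zero_of_not_nonempty
  rintro ⟨π, hπ⟩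
  exact h ⟨π, (mem_pinned_insert.1 hπ).2⟩

theorem SectorBound.sum_norm_slot_le {c : ℝ} (hc : 0 < c) {x : V → V → V → V → ℂ}
    {P : Finset (V × V)} (h : SectorBound c x P) (u : V) :
    c * ∑ s, ‖pinnedSum x (insert (u, s) P)‖ ≤ ‖pinnedSum x P‖ := by
  by_cases hP : (pinned P).Nonempty
  · exact mul_sum_norm_le_of_re _ (sum_sum_pinned_insert_slot P u _)
      (fun s _ => mul_norm_le_re_of_sector hc h.2 u s) (h.1 hP)
  · simp [pinnedSum_insert_eq_zero _ _ hP]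

/-- The vertex occupying the fixed slot `s` varies. The sector condition compares different slots
for one vertex, yet it suffices: each summand is compared with `pinnedSum x P` only. -/
theorem SectorBound.sum_norm_vertex_le {c : ℝ} (hc : 0 < c) {x : V → V → V → V → ℂ}
    {P : Finset (V × V)} (h : SectorBound c x P) (s : V) :
    c * ∑ u, ‖pinnedSum x (insert (u, s) P)‖ ≤ ‖pinnedSum x P‖ := by
  by_cases hP : (pinned P).Nonempty
  · exact mul_sum_norm_le_of_re _ (sum_sum_pinned_insert_vertex P s _)
      (fun u _ => mul_norm_le_re_of_sector hc h.2 u s) (h.1 hP)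
  · simp [pinnedSum_insert_eq_zero _ _ hP]

/-- Weighting the permutations by a function of the slot of one vertex costs at most a factor
`M / c`. -/
theorem SectorBound.norm_sum_mul_le {c : ℝ} (hc : 0 < c) {x : V → V → V → V → ℂ}
    {P : Finset (V × V)} (h : SectorBound c x P) (u : V) {g : V → ℂ} {M : ℝ}
    (hM : 0 ≤ M) (hg : ∀ s, ‖g s‖ ≤ M) :
    ‖∑ π ∈ pinned P, g (π u) * Complex.exp (energy x π)‖ ≤ M * ‖pinnedSum x P‖ / c := by
  rw [← sum_sum_pinned_insert_slot P u, le_div_iff₀ hc]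
  have h1 : ∀ s, ∑ π ∈ pinned (insert (u, s) P), g (π u) * Complex.exp (energy x π) =
      g s * pinnedSum x (insert (u, s) P) := fun s => by
    rw [pinnedSum, mul_sum]
    refine sum_congr rfl fun π hπ => ?_
    rw [(mem_pinned_insert.1 hπ).1]
  simp_rw [h1]
  calc _ ≤ (∑ s, M * ‖pinnedSum x (insert (u, s) P)‖) * c := by
        gcongr
        refine norm_sum_le_of_le _ fun s _ => ?_
        rw [norm_mul]
        gcongr
        exact hg s
    _ = M * (c * ∑ s, ‖pinnedSum x (insert (u, s) P)‖) := by rw [← mul_sum]; ring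
    _ ≤ M * ‖pinnedSum x P‖ := by gcongr; exact h.sum_norm_slot_le hc u

/-! ### Moving one vertex from a slot to another -/

/-- Contribution of the pair `(u, w)` to the derivative of `pinnedSum x P` in a direction `D` that
affects the slots `i` and `j` only, when `v` is held at `i`. -/
theorem norm_sum_pair_le {c : ℝ} (hc : 0 < c) {x D : V → V → V → V → ℂ} {M : V → V → ℝ}
    {P : Finset (V × V)} {v i j : V} (hv : ∀ π ∈ pinned P, π v = i)
    (hDM : ∀ u w s t, ‖D u w s t‖ ≤ M u w)
    (hD : ∀ u w s t, s ≠ i → s ≠ j → t ≠ i → t ≠ j → D u w s t = 0)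
    (hP : SectorBound c x P) (hPj : ∀ u, SectorBound c x (insert (u, j) P)) (u w : V) :
    ‖∑ π ∈ pinned P, D u w (π u) (π w) * Complex.exp (energy x π)‖ ≤
      M u w * ((if u = v then ‖pinnedSum x P‖ else 0) + (if w = v then ‖pinnedSum x P‖ else 0) +
        (‖pinnedSum x (insert (u, j) P)‖ + ‖pinnedSum x (insert (w, j) P)‖)) / c := by
  have hM : 0 ≤ M u w := (norm_nonneg _).trans (hDM u w i i)
  by_cases hu : u = v
  · subst hu
    have h1 : ∑ π ∈ pinned P, D u w (π u) (π w) * Complex.exp (energy x π) =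
        ∑ π ∈ pinned P, D u w i (π w) * Complex.exp (energy x π) :=
      sum_congr rfl fun π hπ => by rw [hv π hπ]
    rw [h1]
    refine (hP.norm_sum_mul_le hc w hM (hDM u w i)).trans ?_
    rw [if_pos rfl, add_assoc]
    gcongr
    exact le_add_of_nonneg_right (by positivity)
  by_cases hw : w = v
  · subst hw
    have h1 : ∑ π ∈ pinned P, D u w (π u) (π w) * Complex.exp (energy x π) =
        ∑ π ∈ pinned P, D u w (π u) i * Complex.exp (energy x π) :=
      sum_congr rfl fun π hπ => by rw [hv π hπ]
    rw [h1]
    refine (hP.norm_sum_mul_le hc u hM fun s => hDM u w s i).trans ?_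
    rw [if_neg hu, if_pos rfl, zero_add]
    gcongr
    exact le_add_of_nonneg_right (by positivity)
  -- Neither vertex sits at `i`, so one of them must sit at `j`.
  have h1 : ∑ π ∈ pinned P, D u w (π u) (π w) * Complex.exp (energy x π) =
      ∑ π ∈ pinned (insert (u, j) P), D u w j (π w) * Complex.exp (energy x π) +
        ∑ π ∈ pinned (insert (w, j) P),
          (if π u = j then 0 else D u w (π u) j) * Complex.exp (energy x π) := by
    rw [sum_pinned_insert, sum_pinned_insert, ← sum_add_distrib]
    refine sum_congr rfl fun π hπ => ?_
    have hui : π u ≠ i := fun h => hu (π.injective (h.trans (hv π hπ).symm))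
    have hwi : π w ≠ i := fun h => hw (π.injective (h.trans (hv π hπ).symm))
    by_cases huj : π u = j
    · simp [huj]
    by_cases hwj : π w = j
    · simp [huj, hwj]
    · simp [huj, hwj, hD u w _ _ hui huj hwi hwj]
  rw [h1, if_neg hu, if_neg hw, add_zero, zero_add, mul_add, add_div]
  refine norm_add_le_of_le ((hPj u).norm_sum_mul_le hc w hM (hDM u w j))
    ((hPj w).norm_sum_mul_le hc u hM (g := fun s => if s = j then 0 else D u w s j) fun s => ?_)
  split_ifs
  · simpa using hM
  · exact hDM u w s j

/-- The derivative of `pinnedSum x P` in a direction `D` that affects the slots `i` and `j` only,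
relative to `pinnedSum x P`. The term `1 / c` comes from the pairs containing the vertex `v` held at
`i`, the term `1 / c ^ 2` from those containing the vertex at `j`. -/
theorem norm_sum_energy_le {c R : ℝ} (hc : 0 < c) {x D : V → V → V → V → ℂ} {M : V → V → ℝ}
    {P : Finset (V × V)} {v i j : V} (hv : ∀ π ∈ pinned P, π v = i)
    (hDM : ∀ u w s t, ‖D u w s t‖ ≤ M u w) (hM : ∀ u, ∑ w, (M u w + M w u) ≤ R)
    (hD : ∀ u w s t, s ≠ i → s ≠ j → t ≠ i → t ≠ j → D u w s t = 0)
    (hP : SectorBound c x P) (hPj : ∀ u, SectorBound c x (insert (u, j) P)) :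
    ‖∑ π ∈ pinned P, energy D π * Complex.exp (energy x π)‖ ≤
      R * (1 / c + 1 / c ^ 2) * ‖pinnedSum x P‖ := by
  have hR : 0 ≤ R := (sum_nonneg fun w _ => add_nonneg ((norm_nonneg _).trans (hDM v w i i))
    ((norm_nonneg _).trans (hDM w v i i))).trans (hM v)
  set Q := ‖pinnedSum x P‖
  set q : V → ℝ := fun u => ‖pinnedSum x (insert (u, j) P)‖ with hq
  have hqs : ∑ u, q u ≤ Q / c := by
    rw [le_div_iff₀ hc, mul_comm]
    exact hP.sum_norm_vertex_le hc j
  have h1 : ∑ π ∈ pinned P, energy D π * Complex.exp (energy x π) =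
      ∑ u, ∑ w, ∑ π ∈ pinned P, D u w (π u) (π w) * Complex.exp (energy x π) := by
    simp_rw [energy, sum_mul]
    rw [sum_comm]
    exact sum_congr rfl fun u _ => sum_comm
  have h2 : ∑ u, ∑ w, M u w * ((if u = v then Q else 0) + (if w = v then Q else 0) + (q u + q w))
      = Q * ∑ w, (M v w + M w v) + ∑ u, q u * ∑ w, (M u w + M w u) := by
    have e1 : ∑ u, ∑ w, M u w * (if u = v then Q else 0) = Q * ∑ w, M v w := by
      rw [sum_comm]; simp [← sum_mul, mul_comm]
    have e2 : ∑ u, ∑ w, M u w * (if w = v then Q else 0) = Q * ∑ w, M w v := by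
      simp [← sum_mul, mul_comm]
    have e3 : ∑ u, ∑ w, M u w * q u = ∑ u, q u * ∑ w, M u w := by
      simp_rw [mul_sum, mul_comm]
    have e4 : ∑ u, ∑ w, M u w * q w = ∑ u, q u * ∑ w, M w u := by
      rw [sum_comm]; simp_rw [mul_sum, mul_comm]
    simp only [mul_add, sum_add_distrib, e1, e2, e3, e4]
  rw [h1]
  calc _ ≤ ∑ u, ∑ w, M u w * ((if u = v then Q else 0) + (if w = v then Q else 0) +
        (q u + q w)) / c :=
        norm_sum_le_of_le _ fun u _ => norm_sum_le_of_le _ fun w _ =>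
          norm_sum_pair_le hc hv hDM hD hP hPj u w
    _ = (Q * ∑ w, (M v w + M w v) + ∑ u, q u * ∑ w, (M u w + M w u)) / c := by
        rw [← h2]; simp_rw [sum_div]
    _ ≤ (Q * R + ∑ u, q u * R) / c := by
        gcongr with u
        · exact hM v
        · exact hM u
    _ ≤ (Q * R + Q / c * R) / c := by
        rw [← sum_mul]; gcongr
    _ = _ := by field_simp

/-- Exchanging two slots in the interaction amounts to moving `v` from one to the other. Both
prescriptions have to be consistent with `P`: this is what keeps `P` itself clear of `i` and `j`. -/
theorem pinnedSum_swap {x : V → V → V → V → ℂ} {P : Finset (V × V)} {v i j : V} (hij : i ≠ j)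
    (hi : (pinned (insert (v, i) P)).Nonempty) (hj : (pinned (insert (v, j) P)).Nonempty) :
    pinnedSum (fun u w s t => x u w (Equiv.swap i j s) (Equiv.swap i j t)) (insert (v, i) P) =
      pinnedSum x (insert (v, j) P) := by
  obtain ⟨σ, hσ⟩ := hi
  obtain ⟨σ', hσ'⟩ := hj
  rw [mem_pinned_insert, mem_pinned] at hσ hσ'
  have hPi : ∀ p ∈ P, p.2 ≠ i ∧ p.2 ≠ j := by
    refine fun p hp => ⟨fun h => ?_, fun h => ?_⟩
    · have h1 : p.1 = v := σ.injective (by rw [hσ.2 p hp, hσ.1, h])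
      exact hij (by rw [← h, ← hσ'.2 p hp, h1, hσ'.1])
    · have h1 : p.1 = v := σ'.injective (by rw [hσ'.2 p hp, hσ'.1, h])
      exact hij (by rw [← h, ← hσ.2 p hp, h1, hσ.1])
  have hP : ∀ π, Equiv.swap i j * π ∈ pinned P ↔ π ∈ pinned P := fun π => by
    simp_rw [mem_pinned]
    refine forall₂_congr fun p hp => ?_
    rw [Equiv.Perm.mul_apply, Equiv.swap_apply_eq_iff,
      Equiv.swap_apply_of_ne_of_ne (hPi p hp).1 (hPi p hp).2]
  refine sum_equiv (Equiv.mulLeft (Equiv.swap i j)) (fun π => ?_) fun π _ => ?_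
  · rw [Equiv.coe_mulLeft, mem_pinned_insert, mem_pinned_insert, hP, Equiv.Perm.mul_apply,
      Equiv.swap_apply_eq_iff, Equiv.swap_apply_right]
  · rw [energy_swap, Equiv.coe_mulLeft]

/-- The inductive step: the sector condition for the sums with `v ↦ i` and `v ↦ j` follows from the
bounds for the sums with more values prescribed. -/
theorem pinnedSum_sector_of_ne {c R : ℝ} (hc : 0 < c) {ρ : V → V → ℝ}
    (hρ : ∀ u, ∑ w, (ρ u w + ρ w u) ≤ R)
    (hRπ : 2 * R * (1 / c + 1 / c ^ 2) ≤ Real.pi)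
    (hcR : c ≤ Real.cos (2 * R * (1 / c + 1 / c ^ 2)))
    {P : Finset (V × V)} {v i j : V} (hij : i ≠ j)
    (hi : (pinned (insert (v, i) P)).Nonempty) (hj : (pinned (insert (v, j) P)).Nonempty)
    (hP : ∀ x : V → V → V → V → ℂ, (∀ u w s t, ‖x u w s t‖ ≤ ρ u w) →
      SectorBound c x (insert (v, i) P) ∧ ∀ u, SectorBound c x (insert (u, j) (insert (v, i) P)))
    {x : V → V → V → V → ℂ} (hx : ∀ u w s t, ‖x u w s t‖ ≤ ρ u w) :
    c * (‖pinnedSum x (insert (v, i) P)‖ * ‖pinnedSum x (insert (v, j) P)‖) ≤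
      (pinnedSum x (insert (v, i) P) * conj (pinnedSum x (insert (v, j) P))).re := by
  set D : V → V → V → V → ℂ := fun u w s t =>
    x u w (Equiv.swap i j s) (Equiv.swap i j t) - x u w s t with hDdef
  set X : ℝ → V → V → V → V → ℂ := fun r u w s t => x u w s t + r * D u w s t with hX
  have hDM : ∀ u w s t, ‖D u w s t‖ ≤ 2 * ρ u w := fun u w s t => by
    rw [two_mul]
    exact norm_sub_le_of_le (hx _ _ _ _) (hx _ _ _ _)
  have hD : ∀ u w s t, s ≠ i → s ≠ j → t ≠ i → t ≠ j → D u w s t = 0 := by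
    intro u w s t h1 h2 h3 h4
    simp [hDdef, Equiv.swap_apply_of_ne_of_ne h1 h2, Equiv.swap_apply_of_ne_of_ne h3 h4]
  have hXρ : ∀ r ∈ Set.Icc (0 : ℝ) 1, ∀ u w s t, ‖X r u w s t‖ ≤ ρ u w := by
    intro r hr u w s t
    have h1 : X r u w s t = (1 - r : ℝ) * x u w s t +
        (r : ℝ) * x u w (Equiv.swap i j s) (Equiv.swap i j t) := by
      simp only [hX, hDdef]; push_cast; ring
    rw [h1]
    calc _ ≤ (1 - r) * ρ u w + r * ρ u w := by
          refine norm_add_le_of_le ?_ ?_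
          · rw [norm_mul, Complex.norm_of_nonneg (sub_nonneg.2 hr.2)]
            exact mul_le_mul_of_nonneg_left (hx _ _ _ _) (sub_nonneg.2 hr.2)
          · rw [norm_mul, Complex.norm_of_nonneg hr.1]
            exact mul_le_mul_of_nonneg_left (hx _ _ _ _) hr.1
      _ = ρ u w := by ring
  have hderiv : ∀ r, HasDerivAt (fun r => pinnedSum (X r) (insert (v, i) P))
      (∑ π ∈ pinned (insert (v, i) P), energy D π * Complex.exp (energy (X r) π)) r := by
    intro r
    refine HasDerivAt.fun_sum fun π _ => ?_
    simp only [hX, energy_segment]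
    have h1 : HasDerivAt (fun r : ℝ => energy x π + r * energy D π) (energy D π) r := by
      simpa using ((Complex.ofRealCLM.hasDerivAt (x := r)).mul_const (energy D π)).const_add
        (energy x π)
    simpa [mul_comm] using h1.cexp
  have hderivc : Continuous fun r =>
      ∑ π ∈ pinned (insert (v, i) P), energy D π * Complex.exp (energy (X r) π) := by
    simp only [hX, energy_segment]
    fun_prop
  have key := cos_mul_norm_le_re_of_norm_deriv_le (C := 2 * R * (1 / c + 1 / c ^ 2))
    hderiv hderivc
    (fun r hr => (hP _ (hXρ r hr)).1.1 hi)
    (fun r hr => norm_sum_energy_le hc (fun π hπ => (mem_pinned_insert.1 hπ).1) hDM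
      (fun u => by
        have h2 : ∀ w, 2 * ρ u w + 2 * ρ w u = 2 * (ρ u w + ρ w u) := fun w => by ring
        simp_rw [h2, ← mul_sum]
        gcongr
        exact hρ u)
      hD (hP _ (hXρ r hr)).1 (hP _ (hXρ r hr)).2) hRπ
  have hX0 : X 0 = x := by simp [hX]
  have hX1 : X 1 = fun u w s t => x u w (Equiv.swap i j s) (Equiv.swap i j t) := by
    simp [hX, hDdef]
  rw [hX0, hX1, pinnedSum_swap hij hi hj] at key
  exact (mul_le_mul_of_nonneg_right hcR (by positivity)).trans key

/-- The sector bound holds throughout a polydisc of interactions. The interaction is generalized in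
the induction because the step moves it along a segment. -/
theorem sectorBound_of_norm_le {c R : ℝ} (hc : 0 < c) {ρ : V → V → ℝ}
    (hρ : ∀ u, ∑ w, (ρ u w + ρ w u) ≤ R)
    (hRπ : 2 * R * (1 / c + 1 / c ^ 2) ≤ Real.pi)
    (hcR : c ≤ Real.cos (2 * R * (1 / c + 1 / c ^ 2))) (P : Finset (V × V))
    {x : V → V → V → V → ℂ} (hx : ∀ u w s t, ‖x u w s t‖ ≤ ρ u w) : SectorBound c x P := by
  induction hn : (pinned P).card using Nat.strong_induction_on generalizing P x with
  | _ n ih =>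
  subst hn
  -- A prescription leaves fewer permutations if a rival one is possible.
  have hlt : ∀ {v i j : V}, i ≠ j → (pinned (insert (v, j) P)).Nonempty →
      (pinned (insert (v, i) P)).card < (pinned P).card := by
    rintro v i j hij ⟨σ, hσ⟩
    rw [mem_pinned_insert] at hσ
    rw [pinned_insert]
    refine card_lt_card (filter_ssubset.2 ⟨σ, hσ.2, fun h => hij (h.symm.trans hσ.1)⟩)
  have hsec : ∀ u s t, c * (‖pinnedSum x (insert (u, s) P)‖ * ‖pinnedSum x (insert (u, t) P)‖) ≤
      (pinnedSum x (insert (u, s) P) * conj (pinnedSum x (insert (u, t) P))).re := by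
    intro v i j
    by_cases hi : (pinned (insert (v, i) P)).Nonempty
    swap
    · simp [pinnedSum_eq_zero_of_not_nonempty hi]
    by_cases hj : (pinned (insert (v, j) P)).Nonempty
    swap
    · simp [pinnedSum_eq_zero_of_not_nonempty hj]
    by_cases hij : i = j
    · subst hij
      rw [Complex.mul_conj, Complex.normSq_eq_norm_sq, Complex.ofReal_re, sq]
      exact mul_le_of_le_one_left (by positivity) (hcR.trans (Real.cos_le_one _))
    · refine pinnedSum_sector_of_ne hc hρ hRπ hcR hij hi hj (fun y hy => ⟨?_, fun u => ?_⟩) hx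
      · exact ih _ (hlt hij hj) _ hy rfl
      · have hle : (pinned (insert (u, j) (insert (v, i) P))).card ≤ (pinned (insert (v, i) P)).card := by
          rw [pinned_insert (insert (v, i) P) u j]
          exact card_le_card (filter_subset _ _)
        exact ih _ (hle.trans_lt (hlt hij hj)) _ hy rfl
  refine ⟨fun hP h0 => ?_, hsec⟩
  obtain ⟨σ, hσ⟩ := hP
  by_cases hall : ∀ π ∈ pinned P, π = σ
  · have h1 : pinned P = {σ} := eq_singleton_iff_unique_mem.2 ⟨hσ, hall⟩
    rw [pinnedSum, h1, sum_singleton] at h0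
    exact Complex.exp_ne_zero _ h0
  · push Not at hall
    obtain ⟨π, hπ, hne⟩ := hall
    -- Some vertex has two possible slots, so prescribing its slot leaves fewer permutations.
    obtain ⟨u, hu⟩ : ∃ u, π u ≠ σ u := by
      by_contra! h
      exact hne (Equiv.ext h)
    have h1 : pinnedSum x (insert (u, σ u) P) ≠ 0 :=
      (ih _ (hlt hu.symm ⟨π, mem_pinned_insert.2 ⟨rfl, hπ⟩⟩) _ hx rfl).1
        ⟨σ, mem_pinned_insert.2 ⟨rfl, hσ⟩⟩
    -- All the fibres lie in one sector around a nonzero one, so they cannot cancel.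
    have h2 := mul_sum_norm_le_re_of_sector hsec u (σ u)
    rw [h0, map_zero, mul_zero, Complex.zero_re] at h2
    have h3 : ‖pinnedSum x (insert (u, σ u) P)‖ ≤ ∑ t, ‖pinnedSum x (insert (u, t) P)‖ :=
      single_le_sum (f := fun t => ‖pinnedSum x (insert (u, t) P)‖)
        (fun _ _ => norm_nonneg _) (mem_univ _)
    have h4 : 0 < ‖pinnedSum x (insert (u, σ u) P)‖ := norm_pos_iff.2 h1
    exact (mul_pos hc (mul_pos h4 (h4.trans_le h3))).not_ge h2

theorem sum_exp_energy_ne_zero {c R : ℝ} (hc : 0 < c) {ρ : V → V → ℝ}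
    (hρ : ∀ u, ∑ w, (ρ u w + ρ w u) ≤ R)
    (hRπ : 2 * R * (1 / c + 1 / c ^ 2) ≤ Real.pi)
    (hcR : c ≤ Real.cos (2 * R * (1 / c + 1 / c ^ 2)))
    {x : V → V → V → V → ℂ} (hx : ∀ u w s t, ‖x u w s t‖ ≤ ρ u w) :
    ∑ π, Complex.exp (energy x π) ≠ 0 := by
  have h := (sectorBound_of_norm_le hc hρ hRπ hcR ∅ hx).1 ⟨1, by simp [mem_pinned]⟩
  have hu : (pinned ∅ : Finset (Equiv.Perm V)) = univ := by ext; simp [mem_pinned]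
  rwa [pinnedSum, hu] at h

end Perm

/-! ### From maps with multiplicities to permutations -/

theorem exists_card_fiber_eq {V : Type*} [Fintype V] [DecidableEq V] {k : ℕ} {m : Fin k → ℕ}
    (hm : ∑ i, m i = Fintype.card V) :
    ∃ φ : V → Fin k, ∀ i, (univ.filter fun v => φ v = i).card = m i := by
  have e : V ≃ Σ i, Fin (m i) := Fintype.equivOfCardEq (by simp [hm])
  refine ⟨fun v => (e v).1, fun i => ?_⟩
  rw [← Fintype.card_subtype]
  have e' : {v // (e v).1 = i} ≃ Fin (m i) :=
    (e.subtypeEquiv (q := fun a => a.1 = i) fun _ => Iff.rfl).trans (Equiv.sigmaSubtype i)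
  simpa using Fintype.card_congr e'

/-- Maps with fibres of equal size differ by a permutation of the domain. -/
theorem exists_perm_comp_eq {V ι : Type*} [Fintype V] [DecidableEq ι] {φ ψ : V → ι}
    (h : ∀ i, (univ.filter fun v => φ v = i).card = (univ.filter fun v => ψ v = i).card) :
    ∃ τ : Equiv.Perm V, φ ∘ τ = ψ := by
  have e : ∀ i, {v // ψ v = i} ≃ {v // φ v = i} := fun i =>
    Fintype.equivOfCardEq (by rw [Fintype.card_subtype, Fintype.card_subtype, h i])
  exact ⟨Equiv.ofFiberEquiv e, funext fun v => Equiv.ofFiberEquiv_map e v⟩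

/-- Every map with the fibre sizes of `φ₀` is `φ₀ ∘ σ` for the same number of permutations `σ`. -/
theorem sum_perm_comp_eq_smul {V : Type*} [Fintype V] [DecidableEq V] {k : ℕ} {m : Fin k → ℕ}
    {φ₀ : V → Fin k} (h₀ : ∀ i, (univ.filter fun v => φ₀ v = i).card = m i)
    (F : (V → Fin k) → ℂ) :
    ∑ σ : Equiv.Perm V, F (φ₀ ∘ σ) =
      (univ.filter fun σ : Equiv.Perm V => φ₀ ∘ σ = φ₀).card •
        ∑ φ : V → Fin k with ∀ i, (univ.filter fun v => φ v = i).card = m i, F φ := by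
  have hmaps : ∀ σ ∈ (univ : Finset (Equiv.Perm V)), φ₀ ∘ σ ∈
      univ.filter fun φ : V → Fin k => ∀ i, (univ.filter fun v => φ v = i).card = m i := by
    intro σ _
    rw [mem_filter]
    refine ⟨mem_univ _, fun i => ?_⟩
    rw [← h₀ i]
    exact card_equiv σ (by simp)
  rw [← sum_fiberwise_of_maps_to hmaps, smul_sum]
  refine sum_congr rfl fun φ hφ => ?_
  rw [mem_filter] at hφ
  obtain ⟨τ, hτ⟩ := exists_perm_comp_eq (φ := φ₀) (ψ := φ) fun i => by rw [h₀ i, hφ.2 i]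
  have hcard : (univ.filter fun σ : Equiv.Perm V => φ₀ ∘ σ = φ).card =
      (univ.filter fun σ : Equiv.Perm V => φ₀ ∘ σ = φ₀).card := by
    refine (card_equiv (Equiv.mulRight τ) fun σ => ?_).symm
    simp only [mem_filter, mem_univ, true_and, Equiv.coe_mulRight, Equiv.Perm.coe_mul, ← hτ,
      ← Function.comp_assoc]
    exact (τ.surjective.injective_comp_right.eq_iff).symm
  rw [← hcard, ← sum_const]
  exact sum_congr rfl fun σ hσ => by rw [(mem_filter.1 hσ).2]

/-- Each edge is counted once for each of its two orientations. -/
theorem sum_adj_eq_two_mul_sum_edge {V : Type*} [Fintype V] [DecidableEq V] (G : SimpleGraph V)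
    [DecidableRel G.Adj] (f : G.edgeSet → ℂ) :
    (∑ u, ∑ w, if h : G.Adj u w then f ⟨s(u, w), h⟩ else 0) = 2 * ∑ e, f e := by
  have h1 : ∀ u w, (if h : G.Adj u w then f ⟨s(u, w), h⟩ else 0) =
      ∑ e : G.edgeSet, if (e : Sym2 V) = s(u, w) then f e else 0 := by
    intro u w
    split_ifs with h
    · rw [sum_eq_single (⟨s(u, w), h⟩ : G.edgeSet)]
      · simp
      · intro e _ he
        exact if_neg fun h' => he (Subtype.ext h')
      · simp
    · refine (sum_eq_zero fun e _ => if_neg fun h' => h ?_).symm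
      rw [← SimpleGraph.mem_edgeSet, ← h']
      exact e.2
  simp_rw [h1]
  rw [← Fintype.sum_prod_type' (f := fun u w => ∑ e : G.edgeSet,
    if (e : Sym2 V) = s(u, w) then f e else 0), sum_comm, mul_sum]
  refine sum_congr rfl fun ⟨e, he⟩ _ => ?_
  induction e with | _ a b
  have hab : a ≠ b := G.ne_of_adj he
  have hfil : (univ.filter fun p : V × V => s(a, b) = s(p.1, p.2)) = {(a, b), (b, a)} := by
    ext ⟨u, w⟩
    simp only [mem_filter, mem_univ, true_and, mem_insert, mem_singleton, Sym2.eq_iff,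
      Prod.mk.injEq]
    grind
  rw [← sum_filter, sum_const, hfil, card_pair (by simp [hab]), nsmul_eq_mul]
  simp

theorem norm_log_le_of_norm_one_sub_le {z : ℂ} {d : ℝ} (hd : 1 ≤ d) (hz : ‖1 - z‖ ≤ 0.107 / d) :
    ‖Complex.log z‖ ≤ 0.1135 / d := by
  have h0 : ‖z - 1‖ ≤ 0.107 / d := by rwa [norm_sub_rev]
  have h1 : 0.107 / d ≤ 0.107 := div_le_self (by norm_num) hd
  have h2 : ‖z - 1‖ ≤ 0.107 := h0.trans h1
  have h3 := Complex.norm_log_one_add_le (z := z - 1) (h2.trans_lt (by norm_num))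
  rw [add_sub_cancel] at h3
  have hinv : (1 - ‖z - 1‖)⁻¹ ≤ 0.893⁻¹ := inv_anti₀ (by norm_num) (by linarith)
  calc ‖Complex.log z‖ ≤ ‖z - 1‖ ^ 2 * (1 - ‖z - 1‖)⁻¹ / 2 + ‖z - 1‖ := h3
    _ ≤ ‖z - 1‖ * 0.107 * 0.893⁻¹ / 2 + ‖z - 1‖ := by
        have hnn : 0 ≤ (1 - ‖z - 1‖)⁻¹ := inv_nonneg.2 (by linarith)
        rw [sq]; gcongr
    _ = ‖z - 1‖ * (0.107 * 0.893⁻¹ / 2 + 1) := by ring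
    _ ≤ 0.107 / d * (0.107 * 0.893⁻¹ / 2 + 1) := by gcongr
    _ = (0.107 * (0.107 * 0.893⁻¹ / 2 + 1)) / d := by ring
    _ ≤ 0.1135 / d := by gcongr; norm_num

theorem theorem2p3 :
    ∃ α : ℝ, 0 < α ∧ α = 0.107 ∧
      ∀ (V : Type*) [Fintype V] [DecidableEq V] (G : SimpleGraph V) [DecidableRel G.Adj],
        1 ≤ G.maxDegree →
        ∀ (k : ℕ) (m : Fin k → ℕ), (∀ i, 0 < m i) → ∑ i, m i = Fintype.card V →
        ∀ Z : Matrix G.edgeSet (Sym2 (Fin k)) ℂ,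
          (∀ (e : G.edgeSet) (p : Sym2 (Fin k)), ‖1 - Z e p‖ ≤ α / (G.maxDegree : ℝ)) →
          partitionFunction G m Z ≠ 0 := by
  refine ⟨0.107, by norm_num, rfl, ?_⟩
  intro V _ _ G _ hG k m _ hm Z hZ hzero
  have hd : (1 : ℝ) ≤ G.maxDegree := by exact_mod_cast hG
  have hd0 : (0 : ℝ) < G.maxDegree := zero_lt_one.trans_le hd
  obtain ⟨φ₀, h₀⟩ := exists_card_fiber_eq hm
  -- Halved, because `energy` counts every edge in both orientations.
  set x : V → V → V → V → ℂ := fun u w s t =>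
    if h : G.Adj u w then Complex.log (Z ⟨s(u, w), h⟩ s(φ₀ s, φ₀ t)) / 2 else 0 with hx
  set ρ : V → V → ℝ := fun u w =>
    if G.Adj u w then 0.1135 / G.maxDegree / 2 else 0 with hρ
  have hZ0 : ∀ e p, Z e p ≠ 0 := fun e p h => by
    have h1 := hZ e p
    have h2 : 0.107 / (G.maxDegree : ℝ) ≤ 0.107 := div_le_self (by norm_num) hd
    rw [h, sub_zero, norm_one] at h1
    norm_num at h2
    linarith
  have hxρ : ∀ u w s t, ‖x u w s t‖ ≤ ρ u w := fun u w s t => by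
    by_cases h : G.Adj u w
    · simp only [hx, hρ, dif_pos h, if_pos h, norm_div, Complex.norm_ofNat]
      gcongr
      exact norm_log_le_of_norm_one_sub_le hd (hZ _ _)
    · simp [hx, hρ, h]
  have hρR : ∀ u, ∑ w, (ρ u w + ρ w u) ≤ 0.1135 := fun u => by
    have h1 : ∀ w, ρ u w + ρ w u = if G.Adj u w then 0.1135 / (G.maxDegree : ℝ) else 0 := by
      intro w
      by_cases h : G.Adj u w
      · simp only [hρ, if_pos h, if_pos h.symm, add_halves]
      · simp [hρ, h, G.adj_comm w u]
    simp_rw [h1]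
    rw [← sum_filter, sum_const, ← SimpleGraph.neighborFinset_eq_filter,
      SimpleGraph.card_neighborFinset_eq_degree, nsmul_eq_mul, mul_div_left_comm]
    refine mul_le_of_le_one_right (by norm_num) (div_le_one_of_le₀ ?_ hd0.le)
    exact_mod_cast G.degree_le_maxDegree u
  have hexp : ∀ π : Equiv.Perm V, Complex.exp (energy x π) =
      ∏ e : G.edgeSet, Z e ((e : Sym2 V).map (φ₀ ∘ π)) := fun π => by
    have h1 : energy x π =
        ∑ e : G.edgeSet, Complex.log (Z e ((e : Sym2 V).map (φ₀ ∘ π))) := by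
      have h2 := sum_adj_eq_two_mul_sum_edge G
        fun e => Complex.log (Z e ((e : Sym2 V).map (φ₀ ∘ π))) / 2
      rw [← sum_div, mul_div_cancel₀ _ two_ne_zero] at h2
      exact h2
    rw [h1, Complex.exp_sum]
    exact prod_congr rfl fun e _ => Complex.exp_log (hZ0 _ _)
  have hθ : 2 * 0.1135 * (1 / 0.755 + 1 / 0.755 ^ 2) ≤ (0.7 : ℝ) := by norm_num
  have hcos : (0.755 : ℝ) ≤ Real.cos (2 * 0.1135 * (1 / 0.755 + 1 / 0.755 ^ 2)) := by
    have h1 : (0.755 : ℝ) ≤ Real.cos 0.7 := by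
      have := Real.one_sub_sq_div_two_le_cos (x := 0.7)
      norm_num at this ⊢
      linarith
    refine h1.trans (Real.cos_le_cos_of_nonneg_of_le_pi (by norm_num) ?_ hθ)
    linarith [Real.pi_gt_three]
  refine sum_exp_energy_ne_zero (c := 0.755) (R := 0.1135) (by norm_num) hρR
    (hθ.trans (by linarith [Real.pi_gt_three])) hcos hxρ ?_
  simp_rw [hexp]
  rw [sum_perm_comp_eq_smul h₀ fun φ => ∏ e : G.edgeSet, Z e ((e : Sym2 V).map φ)]
  rw [partitionFunction] at hzero
  rw [hzero, smul_zero]
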